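/- Let $n\ge 1$ be an integer. There is exactly one function $r\in C^2[0,\infty)$ (one-sided derivatives at $0$) with $r'(t)^2\neq 1$ for all $t>0$ that solves the singular initial value problem $$\frac{r''(t)}{1-(r'(t))^2}+\frac{n-1}{t}\,r'(t)=1\quad (t\in(0,\infty)),\qquad r(0)=r'(0)=0 .$$ Call a $C^2$ function $u:\mathbb R^n\to\mathbb R$ a spacelike soliton solution if $$\operatorname{div}\Big(\frac{\nabla u}{\sqrt{1-|\nabla u|^2}}\Big)=\frac1{\sqrt{1-|\nabla u|^2}}\quad\text{and}\quad |\nabla u|<1\quad\text{on }\mathbb R^n,$$ and call $u$ radially symmetric with vertex $x_0$ if $u(x)$ depends only on $|x-x_0|$. Every spacelike soliton solution $u$ that is radially symmetric with vertex $x_0$ satisfies $$u(x)=r(|x-x_0|)+u(x_0)\qquad\text{for all }x\in\mathbb R^n ,$$ and conversely $x\mapsto r(|x-x_0|)+c$ is a spacelike soliton solution for all $x_0\in\mathbb R^n$, $c\in\mathbb R$. Moreover $r\in C^\infty[0,\infty)$, and for all $t\in[0,\infty)$ $$\frac{t}{\sqrt{n^2+t^2}}\le r'(t)<1,\qquad 0<r''(t)\le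 1 .$$ Consequently, let $u$ be a radially symmetric (with some vertex) spacelike translating soliton of the mean curvature flow in Minkowski space, that is, $V(x,t)=u(x)+t$ is $C^2$ in $x$ with $|\nabla V|<1$ and $$\frac{\partial V}{\partial t}=\sqrt{1-|\nabla V|^2}\,\operatorname{div}\Big(\frac{\nabla V}{\sqrt{1-|\nabla V|^2}}\Big)\quad\text{on }\mathbb R^n\times\mathbb R .$$ Then $u$ is $C^\infty$ on $\mathbb R^n$, strictly convex with everywhere positive definite Hessian, and of linear growth, namely $u(x)/|x|\to1$ as $|x|\to\infty$. Any two such solitons $u,w$ differ by a translation of $\mathbb R^{n+1}$: there are $a\in\mathbb R^n$, $c\in\mathbb R$ with $w(x)=u(x-a)+c$ for all $x$. -/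

import Mathlib

open Set Filter Topology

open scoped ContDiff Gradient

noncomputable section

/-- Divergence of a vector field on `ℝⁿ`: the sum of the partial derivatives `∂ᵢ Fᵢ`. -/
def euclideanDiv {n : ℕ} (F : EuclideanSpace ℝ (Fin n) → EuclideanSpace ℝ (Fin n))
    (x : EuclideanSpace ℝ (Fin n)) : ℝ :=
  ∑ i : Fin n, (fderiv ℝ F x (EuclideanSpace.single i 1)) i

/-- The vector field `∇u / √(1 - |∇u|²)`. -/
def lorentzField {n : ℕ} (u : EuclideanSpace ℝ (Fin n) → ℝ)
    (x : EuclideanSpace ℝ (Fin n)) : EuclideanSpace ℝ (Fin n) :=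
  (Real.sqrt (1 - ‖∇ u x‖ ^ 2))⁻¹ • ∇ u x

/-- `u` is an entire `C²` spacelike solution of
`div (∇u / √(1 - |∇u|²)) = 1 / √(1 - |∇u|²)`. -/
structure IsSolitonSolution {n : ℕ} (u : EuclideanSpace ℝ (Fin n) → ℝ) : Prop where
  contDiff : ContDiff ℝ 2 u
  spacelike : ∀ x, ‖∇ u x‖ < 1
  equation : ∀ x, euclideanDiv (lorentzField u) x = 1 / Real.sqrt (1 - ‖∇ u x‖ ^ 2)

/-- The graphs of `V t`, `t ∈ ℝ`, are entire spacelike `C²` hypersurfaces that evolve by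
`∂V/∂t = √(1 - |∇V|²) div (∇V / √(1 - |∇V|²))`. -/
structure IsSpacelikeMCF {n : ℕ} (V : ℝ → EuclideanSpace ℝ (Fin n) → ℝ) : Prop where
  contDiff : ∀ t, ContDiff ℝ 2 (V t)
  spacelike : ∀ t x, ‖∇ (V t) x‖ < 1
  equation : ∀ t x, HasDerivAt (fun τ => V τ x)
    (Real.sqrt (1 - ‖∇ (V t) x‖ ^ 2) * euclideanDiv (lorentzField (V t)) x) t

/-- `u` is the initial graph of a spacelike solution `V(x, t) = u(x) + t` of the flow. -/
def IsTranslatingSoliton {n : ℕ} (u : EuclideanSpace ℝ (Fin n) → ℝ) : Prop :=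
  IsSpacelikeMCF (fun t x => u x + t)

/-- `u` is radially symmetric with vertex `x₀`: `u x` depends only on `|x - x₀|`. -/
def IsRadialAbout {n : ℕ} (u : EuclideanSpace ℝ (Fin n) → ℝ)
    (x₀ : EuclideanSpace ℝ (Fin n)) : Prop :=
  ∀ x y, ‖x - x₀‖ = ‖y - x₀‖ → u x = u y

/-- `r ∈ C²[0, ∞)` solves `r'' / (1 - r'²) + (n - 1) r' / t = 1` on `(0, ∞)` with
`r(0) = r'(0) = 0`. Derivatives are taken within `[0, ∞)`, so one-sided at `0`; the field
`nondegenerate` says that the quotient in the equation is defined. -/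
structure IsProfile (n : ℕ) (r : ℝ → ℝ) : Prop where
  contDiffOn : ContDiffOn ℝ 2 r (Ici 0)
  nondegenerate : ∀ t ∈ Ioi (0 : ℝ), 1 - derivWithin r (Ici 0) t ^ 2 ≠ 0
  equation : ∀ t ∈ Ioi (0 : ℝ),
    iteratedDerivWithin 2 r (Ici 0) t / (1 - derivWithin r (Ici 0) t ^ 2)
      + ((n : ℝ) - 1) / t * derivWithin r (Ici 0) t = 1
  init : r 0 = 0
  init_deriv : derivWithin r (Ici 0) 0 = 0

end

/-! Put `m = n - 1`. In terms of the momentum `q = r' / √(1 - r'²)` the singular equation becomes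
`(tᵐ q)' = tᵐ √(1 + q²)`, whose right side is 1-Lipschitz in `q`. Integrated and rescaled to `[0,
1]` it reads `q(t) = t ∫₀¹ σᵐ √(1 + q(tσ)²) dσ`, with no trace of the singularity.

Existence: this fixed point equation is a contraction in a space weighted by `exp (2|t|)`. It is
posed on all of `ℝ`, so the solution is odd and `a = q / t` is even. Each pass through the integral
gains a derivative, so `a` is smooth, and so is the slope `t ρ(t)` with `ρ = a / √(1 + t²a²)`.
Evenness lets smoothness pass to functions of `|x - x₀|`, across the vertex.

Uniqueness: `Y = tᵐ q` satisfies `Y' = √(t²ᵐ + Y²)` and a Grönwall argument applies. A radial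
soliton restricted to a ray is a profile, hence is the one constructed.

Estimates: `√(1 + q²) ≥ 1` gives `a ≥ 1 / n`, hence the lower slope bound; a linear barrier for the
slope gives `m ρ < 1`, hence `r'' > 0`. The Hessian has the eigenvalues `r''` and `ρ`, both
positive, and integrating the slope bounds gives linear growth. -/

/-! ### Weighted means along segments from the origin. -/

/-- The weighted mean `∫₀¹ σᵐ b(tσ) dσ` of `b` over the segment from `0` to `t`. -/
noncomputable def radialMean (m : ℕ) (b : ℝ → ℝ) (t : ℝ) : ℝ :=
  ∫ σ in (0 : ℝ)..1, σ ^ m * b (t * σ)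

theorem continuous_radialMean (m : ℕ) {b : ℝ → ℝ} (hb : Continuous b) :
    Continuous (radialMean m b) := by
  apply intervalIntegral.continuous_parametric_intervalIntegral_of_continuous'
  fun_prop

theorem radialMean_zero (m : ℕ) (b : ℝ → ℝ) : radialMean m b 0 = b 0 / (m + 1) := by
  simp [radialMean, integral_pow]
  ring

theorem radialMean_neg (m : ℕ) {b : ℝ → ℝ} (hb : ∀ t, b (-t) = b t) (t : ℝ) :
    radialMean m b (-t) = radialMean m b t := by
  simp [radialMean, hb]

theorem pow_mul_radialMean (m : ℕ) (b : ℝ → ℝ) (t : ℝ) :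
    t ^ (m + 1) * radialMean m b t = ∫ s in (0 : ℝ)..t, s ^ m * b s := by
  have h := intervalIntegral.mul_integral_comp_mul_left (a := 0) (b := 1)
    (f := fun s => s ^ m * b s) t
  rw [mul_zero, mul_one] at h
  rw [← h, radialMean, pow_succ', mul_assoc, ← intervalIntegral.integral_const_mul]
  congr 1
  apply intervalIntegral.integral_congr
  intro σ _
  simp only [mul_pow]
  ring

theorem hasDerivAt_radialMean (m : ℕ) {b : ℝ → ℝ} (hb : ContDiff ℝ 1 b) (t : ℝ) :
    HasDerivAt (radialMean m b) (radialMean (m + 1) (deriv b) t) t := by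
  obtain ⟨hd, hc⟩ := contDiff_one_iff_deriv.1 hb
  have hbc : Continuous b := hb.continuous
  obtain ⟨C, hC⟩ := (isCompact_Icc (a := -(|t| + 1)) (b := |t| + 1)).exists_bound_of_continuousOn
    hc.continuousOn
  refine (intervalIntegral.hasDerivAt_integral_of_dominated_loc_of_deriv_le
    (F := fun t σ => σ ^ m * b (t * σ)) (F' := fun t σ => σ ^ (m + 1) * deriv b (t * σ))
    (bound := fun _ => C) (s := Metric.ball t 1) (Metric.ball_mem_nhds t one_pos) ?_ ?_ ?_ ?_ ?_
    ?_).2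
  · exact Eventually.of_forall fun x => (by fun_prop : Continuous _).aestronglyMeasurable
  · exact (by fun_prop : Continuous _).intervalIntegrable _ _
  · exact (by fun_prop : Continuous _).aestronglyMeasurable
  · refine Eventually.of_forall fun σ hσ x hx => ?_
    rw [uIoc_of_le zero_le_one] at hσ
    have hx' : |x| ≤ |t| + 1 := by
      have h1 : |x - t| < 1 := by simpa [Real.dist_eq] using hx
      have h2 := abs_sub_abs_le_abs_sub x t
      linarith
    have hxs : |x * σ| ≤ |t| + 1 := by
      rw [abs_mul, abs_of_pos hσ.1]
      nlinarith [abs_nonneg x, hσ.1, hσ.2]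
    have h := hC (x * σ) ⟨(abs_le.1 hxs).1, (abs_le.1 hxs).2⟩
    rw [norm_mul, norm_pow, Real.norm_of_nonneg hσ.1.le]
    have h3 : σ ^ (m + 1) ≤ 1 := pow_le_one₀ hσ.1.le hσ.2
    calc σ ^ (m + 1) * ‖deriv b (x * σ)‖ ≤ 1 * ‖deriv b (x * σ)‖ := by gcongr
      _ ≤ C := by simpa using h
  · exact intervalIntegrable_const
  · refine Eventually.of_forall fun σ _ x _ => ?_
    have h := ((hd (x * σ)).hasDerivAt.comp x ((hasDerivAt_id x).mul_const σ)).const_mul (σ ^ m)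
    refine h.congr_deriv ?_
    ring

theorem contDiff_radialMean (k m : ℕ) {b : ℝ → ℝ} (hb : ContDiff ℝ k b) :
    ContDiff ℝ k (radialMean m b) := by
  induction k generalizing m b with
  | zero => exact contDiff_zero.2 (continuous_radialMean m hb.continuous)
  | succ k ih =>
    have h1 : ContDiff ℝ 1 b := hb.of_le (by norm_cast; omega)
    push_cast at hb ⊢
    rw [contDiff_succ_iff_deriv]
    refine ⟨fun t => (hasDerivAt_radialMean m h1 t).differentiableAt, by simp, ?_⟩
    rw [funext fun t => (hasDerivAt_radialMean m h1 t).deriv]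
    exact ih (m + 1) (contDiff_succ_iff_deriv.1 hb).2.2

theorem contDiff_infty_radialMean (m : ℕ) {b : ℝ → ℝ} (hb : ContDiff ℝ ∞ b) :
    ContDiff ℝ ∞ (radialMean m b) :=
  contDiff_infty.2 fun k => contDiff_radialMean k m (contDiff_infty.1 hb k)

/-- Away from `0` the function is `t⁻ᵐ ∫₀ᵗ sᵐ b`; at `0` its difference quotient is the mean itself.
Continuity of `b` suffices, and this gain of one derivative drives the regularity bootstrap. -/
theorem hasDerivAt_mul_radialMean (m : ℕ) {b : ℝ → ℝ} (hb : Continuous b) (t : ℝ) :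
    HasDerivAt (fun t => t * radialMean m b t) (b t - m * radialMean m b t) t := by
  rcases eq_or_ne t 0 with rfl | ht
  · rw [hasDerivAt_iff_tendsto_slope]
    have h : Tendsto (radialMean m b) (𝓝[≠] 0) (𝓝 (radialMean m b 0)) :=
      (continuous_radialMean m hb).continuousAt.tendsto.mono_left nhdsWithin_le_nhds
    have e : b 0 - m * radialMean m b 0 = radialMean m b 0 := by
      rw [radialMean_zero]
      have : (m : ℝ) + 1 ≠ 0 := by positivity
      field_simp
      ring
    rw [e]
    refine h.congr' ?_
    filter_upwards [self_mem_nhdsWithin] with s hs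
    have hs : s ≠ 0 := hs
    simp [slope_def_field, hs]
  · have hi : HasDerivAt (fun t => ∫ s in (0 : ℝ)..t, s ^ m * b s) (t ^ m * b t) t :=
      (by fun_prop : Continuous fun s => s ^ m * b s).integral_hasStrictDerivAt 0 t |>.hasDerivAt
    have hp := (hasDerivAt_pow m t)
    have h := hi.div hp (pow_ne_zero m ht)
    have e : (fun t => t * radialMean m b t) =ᶠ[𝓝 t]
        (fun t => ∫ s in (0 : ℝ)..t, s ^ m * b s) / fun t => t ^ m := by
      filter_upwards [isOpen_ne.mem_nhds ht] with s hs
      have hs : s ≠ 0 := hs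
      simp only [Pi.div_apply]
      rw [← pow_mul_radialMean]
      field_simp
      ring
    refine (h.congr_of_eventuallyEq e).congr_deriv ?_
    rw [← pow_mul_radialMean]
    cases m with
    | zero => simp
    | succ m =>
      simp only [Nat.add_sub_cancel]
      field_simp
      ring

theorem contDiff_mul_radialMean (k m : ℕ) {b : ℝ → ℝ} (hb : ContDiff ℝ k b) :
    ContDiff ℝ (k + 1 : ℕ) (fun t => t * radialMean m b t) := by
  push_cast
  rw [contDiff_succ_iff_deriv]
  have h := hasDerivAt_mul_radialMean m hb.continuous
  refine ⟨fun t => (h t).differentiableAt, by simp, ?_⟩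
  rw [funext fun t => (h t).deriv]
  exact hb.sub (contDiff_const.mul (contDiff_radialMean k m hb))

/-! ### Parity of derivatives. -/

theorem deriv_neg_of_even {g : ℝ → ℝ} (hg : ∀ t, g (-t) = g t) (t : ℝ) :
    deriv g (-t) = -deriv g t := by
  have h := deriv_comp_neg g t
  rw [funext hg] at h
  rw [h, neg_neg]

theorem deriv_neg_of_odd {g : ℝ → ℝ} (hg : ∀ t, g (-t) = -g t) (t : ℝ) :
    deriv g (-t) = deriv g t := by
  have h := deriv_comp_neg g t
  rw [funext hg] at h
  have h2 : deriv (fun x => -g x) t = -deriv g t := deriv.fun_neg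
  linarith

/-- The derivative of an even smooth function is `t` times an even smooth function. -/
theorem exists_deriv_eq_mul_of_even {g : ℝ → ℝ} (hg : ContDiff ℝ ∞ g) (he : ∀ t, g (-t) = g t) :
    ∃ h : ℝ → ℝ, ContDiff ℝ ∞ h ∧ (∀ t, h (-t) = h t) ∧ ∀ t, deriv g t = t * h t := by
  have h1 : ContDiff ℝ ∞ (deriv g) := (contDiff_infty_iff_deriv.1 hg).2
  have h2 : ContDiff ℝ ∞ (deriv (deriv g)) := (contDiff_infty_iff_deriv.1 h1).2
  -- `g'` is odd, so `g'(0) = 0` and `g'(t) = ∫₀ᵗ g'' = t ∫₀¹ g''(tσ) dσ`.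
  refine ⟨radialMean 0 (deriv (deriv g)), contDiff_infty_radialMean 0 h2,
    radialMean_neg 0 (deriv_neg_of_odd (deriv_neg_of_even he)), fun t => ?_⟩
  have h := pow_mul_radialMean 0 (deriv (deriv g)) t
  have h0 : deriv g 0 = 0 := by
    have := deriv_neg_of_even he 0
    rw [neg_zero] at this
    linarith
  simp only [zero_add, pow_one, pow_zero, one_mul] at h
  rw [h, intervalIntegral.integral_deriv_eq_sub
    (fun x _ => (h1.differentiable (by simp)) x) (h2.continuous.intervalIntegrable _ _), h0, sub_zero]

/-! ### The momentum equation as a contraction. -/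

/-- Reverse triangle inequality for the plane vectors `(√c, x)` and `(√c, y)`. The Lipschitz
constant 1 serves both the contraction and the uniqueness of profiles. -/
theorem abs_sqrt_add_sq_sub_le {c : ℝ} (hc : 0 ≤ c) (x y : ℝ) :
    |√(c + x ^ 2) - √(c + y ^ 2)| ≤ |x - y| := by
  have hx := Real.sq_sqrt (by positivity : 0 ≤ c + x ^ 2)
  have hy := Real.sq_sqrt (by positivity : 0 ≤ c + y ^ 2)
  have hx0 := Real.sqrt_nonneg (c + x ^ 2)
  have hy0 := Real.sqrt_nonneg (c + y ^ 2)
  rw [← sq_le_sq]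
  have h : c + x * y ≤ √(c + x ^ 2) * √(c + y ^ 2) := by
    rw [← Real.sqrt_mul (by positivity)]
    apply Real.le_sqrt_of_sq_le
    nlinarith [mul_nonneg hc (sq_nonneg (x - y))]
  nlinarith

/-- The exact value is `(1 - exp (-2|t|)) / 2`: the weight's rate 2 produces the contraction factor
`1 / 2`. -/
theorem integral_abs_mul_exp_le (t : ℝ) :
    ∫ σ in (0 : ℝ)..1, |t| * Real.exp (-2 * |t| * (1 - σ)) ≤ 1 / 2 := by
  have h : ∀ σ ∈ uIcc (0 : ℝ) 1, HasDerivAt (fun σ => Real.exp (-2 * |t| * (1 - σ)) / 2)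
      (|t| * Real.exp (-2 * |t| * (1 - σ))) σ := by
    intro σ _
    have h1 : HasDerivAt (fun σ : ℝ => -2 * |t| * (1 - σ)) (2 * |t|) σ := by
      simpa using ((hasDerivAt_id σ).const_sub 1).const_mul (-2 * |t|)
    exact (h1.exp.div_const 2).congr_deriv (by ring)
  rw [intervalIntegral.integral_eq_sub_of_hasDerivAt h
    ((by fun_prop : Continuous _).intervalIntegrable _ _)]
  simp
  positivity

theorem abs_mul_integral_exp_mul_le (m : ℕ) (t : ℝ) {f : ℝ → ℝ} {C : ℝ} (hf : Continuous f)
    (hC : ∀ σ, |f σ| ≤ C) :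
    |t * ∫ σ in (0 : ℝ)..1, σ ^ m * (Real.exp (-2 * |t| * (1 - σ)) * f σ)| ≤ C / 2 := by
  have hC0 : 0 ≤ C := (abs_nonneg _).trans (hC 0)
  rw [← intervalIntegral.integral_const_mul]
  calc |∫ σ in (0 : ℝ)..1, t * (σ ^ m * (Real.exp (-2 * |t| * (1 - σ)) * f σ))|
      ≤ ∫ σ in (0 : ℝ)..1, |t * (σ ^ m * (Real.exp (-2 * |t| * (1 - σ)) * f σ))| :=
        intervalIntegral.abs_integral_le_integral_abs zero_le_one
    _ ≤ ∫ σ in (0 : ℝ)..1, C * (|t| * Real.exp (-2 * |t| * (1 - σ))) := by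
        apply intervalIntegral.integral_mono_on zero_le_one
        · exact (by fun_prop : Continuous _).intervalIntegrable _ _
        · exact (by fun_prop : Continuous _).intervalIntegrable _ _
        · intro σ hσ
          rw [abs_mul, abs_mul, abs_mul, abs_pow, abs_of_nonneg hσ.1, Real.abs_exp]
          calc |t| * (σ ^ m * (Real.exp (-2 * |t| * (1 - σ)) * |f σ|))
              ≤ |t| * (1 * (Real.exp (-2 * |t| * (1 - σ)) * C)) := by
                have h1 := pow_le_one₀ hσ.1 hσ.2 (n := m)
                have h2 := hC σ
                have h3 := pow_nonneg hσ.1 m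
                gcongr
            _ = _ := by ring
    _ ≤ C * (1 / 2) := by
        rw [intervalIntegral.integral_const_mul]
        exact mul_le_mul_of_nonneg_left (integral_abs_mul_exp_le t) hC0
    _ = C / 2 := by ring

open scoped BoundedContinuousFunction

/-- The Picard operator `q ↦ t ∫₀¹ σᵐ √(1 + q(tσ)²) dσ`, conjugated by the weight `exp (2|t|)`. -/
noncomputable def weightedPicard (m : ℕ) (b : ℝ →ᵇ ℝ) : ℝ →ᵇ ℝ :=
  BoundedContinuousFunction.ofNormedAddCommGroup
    (fun t => t * ∫ σ in (0 : ℝ)..1, σ ^ m *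
      (Real.exp (-2 * |t| * (1 - σ)) * √(Real.exp (-4 * |t * σ|) + b (t * σ) ^ 2)))
    (by
      refine continuous_id.mul
        (intervalIntegral.continuous_parametric_intervalIntegral_of_continuous' ?_ _ _)
      fun_prop)
    ((1 + ‖b‖) / 2)
    (by
      intro t
      refine abs_mul_integral_exp_mul_le m t (by fun_prop) fun σ => ?_
      rw [abs_of_nonneg (Real.sqrt_nonneg _)]
      apply Real.sqrt_le_iff.2 ⟨by positivity, ?_⟩
      have h1 : Real.exp (-4 * |t * σ|) ≤ 1 := Real.exp_le_one_iff.2 (by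
        have := abs_nonneg (t * σ)
        linarith)
      have h2 : b (t * σ) ^ 2 ≤ ‖b‖ ^ 2 := sq_le_sq' (by
        have := abs_le.1 (b.norm_coe_le_norm (t * σ)); exact this.1)
        (le_trans (le_abs_self _) (b.norm_coe_le_norm (t * σ)))
      nlinarith [norm_nonneg b])

theorem weightedPicard_apply (m : ℕ) (b : ℝ →ᵇ ℝ) (t : ℝ) :
    weightedPicard m b t = t * ∫ σ in (0 : ℝ)..1, σ ^ m *
      (Real.exp (-2 * |t| * (1 - σ)) * √(Real.exp (-4 * |t * σ|) + b (t * σ) ^ 2)) := rfl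

/-- With `q = exp (2|t|) b`, moving the weight from `tσ` to `t` leaves the kernel `exp (-2|t|(1 -
σ))`, which makes the estimate uniform over the whole line. -/
theorem contractingWith_weightedPicard (m : ℕ) :
    ContractingWith (1 / 2) (weightedPicard m) := by
  refine ⟨by rw [div_lt_one] <;> norm_num, LipschitzWith.of_dist_le_mul fun b c => ?_⟩
  rw [BoundedContinuousFunction.dist_le (by positivity)]
  intro t
  rw [Real.dist_eq, weightedPicard_apply, weightedPicard_apply, ← mul_sub,
    ← intervalIntegral.integral_sub ((by fun_prop : Continuous _).intervalIntegrable _ _)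
      ((by fun_prop : Continuous _).intervalIntegrable _ _)]
  simp_rw [← mul_sub]
  refine (abs_mul_integral_exp_mul_le m t (by fun_prop) (C := dist b c) fun σ => ?_).trans_eq ?_
  · refine (abs_sqrt_add_sq_sub_le (Real.exp_pos _).le _ _).trans ?_
    rw [← Real.dist_eq]
    exact BoundedContinuousFunction.dist_coe_le_dist (t * σ)
  · push_cast
    ring

theorem exists_odd_eq_mul_radialMean (m : ℕ) :
    ∃ q : ℝ → ℝ, Continuous q ∧ (∀ t, q (-t) = -q t) ∧
      ∀ t, q t = t * radialMean m (fun s => √(1 + q s ^ 2)) t := by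
  set b := ContractingWith.fixedPoint _ (contractingWith_weightedPicard m) with hb_def
  have hb : weightedPicard m b = b :=
    (contractingWith_weightedPicard m).fixedPoint_isFixedPt
  have hodd : ∀ t, b (-t) = -b t := by
    -- The operator commutes with `b ↦ -b(-·)`, so the reflected function is also a fixed point and
    -- uniqueness forces oddness.
    set c : ℝ →ᵇ ℝ := -b.compContinuous ⟨fun t => -t, continuous_neg⟩ with hc
    have hc' : ∀ t, c t = -b (-t) := fun t => rfl
    have hcf : weightedPicard m c = c := by
      ext t
      rw [hc', ← hb, weightedPicard_apply, weightedPicard_apply]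
      simp [hc']
    have := (contractingWith_weightedPicard m).fixedPoint_unique' hcf hb
    intro t
    rw [← this, hc', this, neg_neg]
  refine ⟨fun t => Real.exp (2 * |t|) * b t, by fun_prop, fun t => ?_, fun t => ?_⟩
  · simp [hodd]
  · beta_reduce
    conv_lhs => rw [← hb, weightedPicard_apply]
    rw [mul_left_comm, radialMean, ← intervalIntegral.integral_const_mul]
    congr 1
    apply intervalIntegral.integral_congr
    intro σ hσ
    rw [uIcc_of_le zero_le_one] at hσ
    have h1 : 1 + (Real.exp (2 * |t * σ|) * b (t * σ)) ^ 2 =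
        Real.exp (2 * |t * σ|) ^ 2 * (Real.exp (-4 * |t * σ|) + b (t * σ) ^ 2) := by
      rw [mul_add, mul_pow, ← Real.exp_nat_mul, ← Real.exp_add]
      norm_num
      rw [← Real.exp_zero]
      congr 1
      ring
    simp only
    rw [h1, Real.sqrt_mul (by positivity), Real.sqrt_sq (by positivity)]
    have h2 : Real.exp (2 * |t * σ|) =
        Real.exp (2 * |t|) * Real.exp (-2 * |t| * (1 - σ)) := by
      rw [← Real.exp_add, abs_mul, abs_of_nonneg hσ.1]
      ring_nf
    rw [h2]
    ring

/-- The odd smooth solution of `(tᵐ q)' = tᵐ √(1 + q²)`, in integrated form. -/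
theorem exists_smooth_odd_eq_mul_radialMean (m : ℕ) :
    ∃ q : ℝ → ℝ, ContDiff ℝ ∞ q ∧ (∀ t, q (-t) = -q t) ∧
      ∀ t, q t = t * radialMean m (fun s => √(1 + q s ^ 2)) t := by
  obtain ⟨q, hc, ho, hq⟩ := exists_odd_eq_mul_radialMean m
  refine ⟨q, contDiff_infty.2 fun k => ?_, ho, hq⟩
  induction k with
  | zero => exact contDiff_zero.2 hc
  | succ k ih =>
    -- If `q` is `Cᵏ` then so is `√(1 + q²)`, and the right side of the equation is `Cᵏ⁺¹`.
    rw [funext hq]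
    exact contDiff_mul_radialMean k m
      ((contDiff_const.add (ih.pow 2)).sqrt fun t => by positivity)

/-! ### The radial momentum and its profile. -/

/-- `a` is an even smooth function such that the radial field `a(|x|) x` on `ℝᵐ⁺¹` has divergence
`√(1 + |a(|x|) x|²)`, written as an ordinary differential equation. -/
structure IsRadialMomentum (m : ℕ) (a : ℝ → ℝ) : Prop where
  contDiff : ContDiff ℝ ∞ a
  even : ∀ t, a (-t) = a t
  equation : ∀ t, t * deriv a t + (m + 1) * a t = √(1 + (t * a t) ^ 2)
  lower : ∀ t, 1 / ((m : ℝ) + 1) ≤ a t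

/-- The mean of `√(1 + q²)` is `q / t` extended smoothly across `0`. The equation comes from
differentiating `t a(t)` in two ways, the lower bound from `√(1 + q²) ≥ 1`. -/
theorem exists_isRadialMomentum (m : ℕ) : ∃ a, IsRadialMomentum m a := by
  obtain ⟨q, hq, ho, he⟩ := exists_smooth_odd_eq_mul_radialMean m
  have hb : ContDiff ℝ ∞ fun s => √(1 + q s ^ 2) :=
    (contDiff_const.add (hq.pow 2)).sqrt fun t => by positivity
  have ha := contDiff_infty_radialMean m hb
  refine ⟨radialMean m fun s => √(1 + q s ^ 2), ha, ?_, fun t => ?_, fun t => ?_⟩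
  · exact radialMean_neg m fun t => by rw [ho, neg_sq]
  · have h1 := hasDerivAt_mul_radialMean m hb.continuous t
    have h2 := (hasDerivAt_id t).mul (ha.differentiable (by simp) t).hasDerivAt
    have h3 := h1.unique h2
    simp only [id] at h3
    rw [← he]
    linarith
  · have h1 : ∫ σ in (0 : ℝ)..1, σ ^ m = 1 / ((m : ℝ) + 1) := by simp [integral_pow]
    rw [← h1]
    have hc := hb.continuous
    refine intervalIntegral.integral_mono_on zero_le_one
      ((by fun_prop : Continuous _).intervalIntegrable _ _)
      ((by fun_prop : Continuous _).intervalIntegrable _ _) fun σ hσ => ?_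
    have h2 : 1 ≤ √(1 + q (t * σ) ^ 2) := Real.one_le_sqrt.2 (by nlinarith [sq_nonneg (q (t * σ))])
    nlinarith [pow_nonneg hσ.1 m]

/-- The Lorentz factor `√(1 + (t a(t))²)`. -/
noncomputable def lorentzFactor (a : ℝ → ℝ) (t : ℝ) : ℝ := √(1 + (t * a t) ^ 2)

/-- The function `ρ` for which the slope of the profile is `t ρ(t)`. -/
noncomputable def slopeQuotient (a : ℝ → ℝ) (t : ℝ) : ℝ := a t / lorentzFactor a t

/-- The profile with slope `t ρ(t)`. -/
noncomputable def radialProfile (a : ℝ → ℝ) (t : ℝ) : ℝ :=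
  ∫ s in (0 : ℝ)..t, s * slopeQuotient a s

theorem lorentzFactor_sq (a : ℝ → ℝ) (t : ℝ) : lorentzFactor a t ^ 2 = 1 + (t * a t) ^ 2 :=
  Real.sq_sqrt (by positivity)

theorem one_le_lorentzFactor (a : ℝ → ℝ) (t : ℝ) : 1 ≤ lorentzFactor a t :=
  Real.one_le_sqrt.2 (by nlinarith [sq_nonneg (t * a t)])

theorem lorentzFactor_pos (a : ℝ → ℝ) (t : ℝ) : 0 < lorentzFactor a t :=
  one_pos.trans_le (one_le_lorentzFactor a t)

theorem one_sub_slope_sq (a : ℝ → ℝ) (t : ℝ) :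
    1 - (t * slopeQuotient a t) ^ 2 = (lorentzFactor a t ^ 2)⁻¹ := by
  have h := lorentzFactor_pos a t
  rw [slopeQuotient, ← mul_div_assoc, div_pow]
  field_simp
  rw [lorentzFactor_sq]
  ring

theorem slope_lt_one (a : ℝ → ℝ) (t : ℝ) : t * slopeQuotient a t < 1 := by
  have h := lorentzFactor_pos a t
  have h1 := one_sub_slope_sq a t
  have h2 : 0 < (lorentzFactor a t ^ 2)⁻¹ := by positivity
  nlinarith

namespace IsRadialMomentum

variable {m : ℕ} {a : ℝ → ℝ}

theorem pos (h : IsRadialMomentum m a) (t : ℝ) : 0 < a t :=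
  lt_of_lt_of_le (by positivity) (h.lower t)

theorem contDiff_lorentzFactor (h : IsRadialMomentum m a) : ContDiff ℝ ∞ (lorentzFactor a) :=
  (contDiff_const.add ((contDiff_id.mul h.contDiff).pow 2)).sqrt fun t => by positivity

theorem lorentzFactor_neg (h : IsRadialMomentum m a) (t : ℝ) :
    lorentzFactor a (-t) = lorentzFactor a t := by
  simp [lorentzFactor, h.even]

theorem contDiff_slopeQuotient (h : IsRadialMomentum m a) : ContDiff ℝ ∞ (slopeQuotient a) :=
  h.contDiff.div h.contDiff_lorentzFactor fun t => (lorentzFactor_pos a t).ne'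

theorem slopeQuotient_neg (h : IsRadialMomentum m a) (t : ℝ) :
    slopeQuotient a (-t) = slopeQuotient a t := by
  rw [slopeQuotient, slopeQuotient, h.even, h.lorentzFactor_neg]

theorem slopeQuotient_pos (h : IsRadialMomentum m a) (t : ℝ) : 0 < slopeQuotient a t :=
  div_pos (h.pos t) (lorentzFactor_pos a t)

theorem hasDerivAt_radialProfile (h : IsRadialMomentum m a) (t : ℝ) :
    HasDerivAt (radialProfile a) (t * slopeQuotient a t) t :=
  ((continuous_id.mul h.contDiff_slopeQuotient.continuous).integral_hasStrictDerivAt 0 t).hasDerivAt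

theorem deriv_radialProfile (h : IsRadialMomentum m a) :
    deriv (radialProfile a) = fun t => t * slopeQuotient a t :=
  funext fun t => (h.hasDerivAt_radialProfile t).deriv

theorem contDiff_radialProfile (h : IsRadialMomentum m a) : ContDiff ℝ ∞ (radialProfile a) := by
  rw [contDiff_infty_iff_deriv]
  refine ⟨fun t => (h.hasDerivAt_radialProfile t).differentiableAt, ?_⟩
  rw [h.deriv_radialProfile]
  exact contDiff_id.mul h.contDiff_slopeQuotient

theorem radialProfile_neg (h : IsRadialMomentum m a) (t : ℝ) :
    radialProfile a (-t) = radialProfile a t := by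
  have e : ∀ s, HasDerivAt (fun s => radialProfile a (-s) - radialProfile a s) 0 s := by
    intro s
    have h1 := (h.hasDerivAt_radialProfile (-s)).comp s (hasDerivAt_neg s)
    refine (h1.sub (h.hasDerivAt_radialProfile s)).congr_deriv ?_
    rw [h.slopeQuotient_neg]
    ring
  have := is_const_of_deriv_eq_zero (fun s => (e s).differentiableAt) (fun s => (e s).deriv) t 0
  simp only [neg_zero, sub_self] at this
  linarith

/-- The radial equation gives `q' = √(1 + q²) - m a` for `q = t a`, and `q ↦ q / √(1 + q²)` has
derivative `(1 + q²)^(-3/2)`. -/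
theorem hasDerivAt_slope (h : IsRadialMomentum m a) (t : ℝ) :
    HasDerivAt (fun t => t * slopeQuotient a t)
      ((lorentzFactor a t - m * a t) / lorentzFactor a t ^ 3) t := by
  have hb := lorentzFactor_pos a t
  have h1 : HasDerivAt (fun t => t * a t) (lorentzFactor a t - m * a t) t := by
    have := (hasDerivAt_id t).mul (h.contDiff.differentiable (by simp) t).hasDerivAt
    refine this.congr_deriv ?_
    rw [lorentzFactor, ← h.equation]
    simp only [id]
    ring
  have h2 := ((h1.pow 2).const_add 1).sqrt (by simp only [Pi.pow_apply]; positivity)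
  have h3 := h1.div h2 (lorentzFactor_pos a t).ne'
  have e : (fun t => t * slopeQuotient a t) =
      (fun t => t * a t) / fun t => √(1 + ((fun t => t * a t) ^ 2) t) := by
    funext s
    simp only [slopeQuotient, lorentzFactor, Pi.div_apply, Pi.pow_apply]
    ring
  rw [e]
  refine h3.congr_deriv ?_
  have e2 : √(1 + ((fun t => t * a t) ^ 2) t) = lorentzFactor a t := rfl
  rw [e2]
  field_simp
  have hsq := lorentzFactor_sq a t
  simp only [Nat.cast_ofNat, Nat.add_one_sub_one, pow_one]
  linear_combination 2 * (lorentzFactor a t - m * a t) * hsq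

/-- A line of slope `C` is a strict upper barrier if `1 - m C < C`, and it yields `m ρ < 1` if `m C
< 1`. So `C` must lie between `1 / (m + 1)` and `1 / m`; `2 / (2m + 1)` does. -/
theorem slope_le (h : IsRadialMomentum m a) {t : ℝ} (ht : 0 ≤ t) :
    t * slopeQuotient a t ≤ 2 / (2 * m + 1) * t := by
  have hd : ∀ t, HasDerivAt (fun t : ℝ => 2 / (2 * (m : ℝ) + 1) * t) (2 / (2 * m + 1)) t := fun t => by
    simpa using (hasDerivAt_id t).const_mul (2 / (2 * (m : ℝ) + 1))
  refine image_le_of_deriv_right_lt_deriv_boundary (a := 0) (b := t)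
    (fun s _ => (h.hasDerivAt_slope s).continuousAt.continuousWithinAt)
    (fun s _ => (h.hasDerivAt_slope s).hasDerivWithinAt) (by simp) hd ?_ ⟨ht, le_rfl⟩
  intro s hs e
  have hb := lorentzFactor_pos a s
  have hb1 := one_le_lorentzFactor a s
  have hm : (0 : ℝ) ≤ m := m.cast_nonneg
  -- Contact at `s > 0` determines `ρ(s)`. Contact at `0` is automatic and says nothing, so there
  -- the value `ρ(0) = 1 / (m + 1)` is used.
  have hρ : m * slopeQuotient a s ≤ 2 * m / (2 * m + 1) ∧
      2 * m / (2 * m + 1) - 1 / (2 * m + 1) < m * slopeQuotient a s ∨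
      m * slopeQuotient a s = 2 * m / (2 * m + 1) := by
    rcases hs.1.eq_or_lt with rfl | h0
    · left
      have e0 := h.equation 0
      simp only [zero_mul, zero_add, ne_eq, OfNat.ofNat_ne_zero, not_false_eq_true, zero_pow,
        add_zero, Real.sqrt_one] at e0
      have e1 : slopeQuotient a 0 = 1 / (m + 1) := by
        simp only [slopeQuotient, lorentzFactor, zero_mul, ne_eq, OfNat.ofNat_ne_zero,
          not_false_eq_true, zero_pow, add_zero, Real.sqrt_one, div_one]
        field_simp
        linarith
      rw [e1]
      constructor
      · rw [mul_one_div, div_le_div_iff₀ (by positivity) (by positivity)]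
        nlinarith
      · rw [mul_one_div, ← sub_div, div_lt_div_iff₀ (by positivity) (by positivity)]
        nlinarith
    · right
      have : slopeQuotient a s = 2 / (2 * m + 1) := by
        rw [mul_comm] at e
        exact mul_right_cancel₀ h0.ne' e
      rw [this]
      ring
  have e3 : (lorentzFactor a s - m * a s) / lorentzFactor a s ^ 3 =
      (1 - m * slopeQuotient a s) / lorentzFactor a s ^ 2 := by
    rw [slopeQuotient]
    field_simp
  rw [e3, div_lt_iff₀ (by positivity)]
  have hb2 : 1 ≤ lorentzFactor a s ^ 2 := one_le_pow₀ hb1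
  have h2 : (2 : ℝ) * m / (2 * m + 1) = 1 - 1 / (2 * m + 1) := by
    field_simp
    ring
  have h3 : (2 : ℝ) / (2 * m + 1) = 2 * (1 / (2 * m + 1)) := by ring
  have h4 : (0 : ℝ) < 1 / (2 * m + 1) := by positivity
  rw [h3]
  rw [h2] at hρ
  have h5 : 1 - m * slopeQuotient a s < 2 * (1 / (2 * m + 1)) := by
    rcases hρ with hρ | hρ <;> linarith [hρ]
  nlinarith

theorem mul_lt_lorentzFactor (h : IsRadialMomentum m a) {t : ℝ} (ht : 0 ≤ t) :
    m * a t < lorentzFactor a t := by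
  have hb := lorentzFactor_pos a t
  rcases ht.eq_or_lt with rfl | h0
  · have e0 := h.equation 0
    have := h.pos 0
    rw [lorentzFactor, ← e0]
    linarith
  · have h1 := h.slope_le ht
    have h2 : slopeQuotient a t ≤ 2 / (2 * m + 1) := by
      rw [mul_comm] at h1
      exact le_of_mul_le_mul_right h1 h0
    rw [slopeQuotient, div_le_div_iff₀ hb (by positivity)] at h2
    have := h.pos t
    linarith

theorem deriv_slope_pos (h : IsRadialMomentum m a) {t : ℝ} (ht : 0 ≤ t) :
    0 < (lorentzFactor a t - m * a t) / lorentzFactor a t ^ 3 :=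
  div_pos (sub_pos.2 (h.mul_lt_lorentzFactor ht)) (pow_pos (lorentzFactor_pos a t) 3)

theorem deriv_slope_le_one (h : IsRadialMomentum m a) (t : ℝ) :
    (lorentzFactor a t - m * a t) / lorentzFactor a t ^ 3 ≤ 1 := by
  have hb := one_le_lorentzFactor a t
  rw [div_le_one (by positivity)]
  have h1 : 0 ≤ m * a t := mul_nonneg m.cast_nonneg (h.pos t).le
  have h2 : lorentzFactor a t ≤ lorentzFactor a t ^ 3 := le_self_pow₀ hb (by norm_num)
  linarith

/-- `a / √(1 + t²a²)` increases with `a`, and `a ≥ 1 / (m + 1)`. -/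
theorem le_slope (h : IsRadialMomentum m a) {t : ℝ} (ht : 0 ≤ t) :
    t / √(((m : ℝ) + 1) ^ 2 + t ^ 2) ≤ t * slopeQuotient a t := by
  have hb := lorentzFactor_pos a t
  have ha := h.pos t
  rw [slopeQuotient, div_eq_mul_one_div]
  refine mul_le_mul_of_nonneg_left ?_ ht
  rw [div_le_div_iff₀ (by positivity) hb, one_mul, lorentzFactor,
    ← Real.sqrt_sq ha.le, ← Real.sqrt_mul (by positivity)]
  apply Real.sqrt_le_sqrt
  rw [Real.sqrt_sq ha.le]
  have h1 : 1 ≤ a t * (m + 1) := by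
    have := h.lower t
    rwa [div_le_iff₀ (by positivity)] at this
  nlinarith

theorem derivWithin_radialProfile (h : IsRadialMomentum m a) {t : ℝ} (ht : t ∈ Ici (0 : ℝ)) :
    derivWithin (radialProfile a) (Ici 0) t = t * slopeQuotient a t :=
  (h.hasDerivAt_radialProfile t).hasDerivWithinAt.derivWithin (uniqueDiffOn_Ici 0 t ht)

theorem iteratedDerivWithin_two_radialProfile (h : IsRadialMomentum m a) {t : ℝ}
    (ht : t ∈ Ici (0 : ℝ)) :
    iteratedDerivWithin 2 (radialProfile a) (Ici 0) t =
      (lorentzFactor a t - m * a t) / lorentzFactor a t ^ 3 := by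
  rw [show (2 : ℕ) = 1 + 1 from rfl, iteratedDerivWithin_succ, iteratedDerivWithin_one]
  rw [derivWithin_congr (fun s hs => h.derivWithin_radialProfile hs)
    (h.derivWithin_radialProfile ht)]
  exact (h.hasDerivAt_slope t).hasDerivWithinAt.derivWithin (uniqueDiffOn_Ici 0 t ht)

theorem isProfile (h : IsRadialMomentum m a) : IsProfile (m + 1) (radialProfile a) where
  contDiffOn := (h.contDiff_radialProfile.of_le (by norm_cast)).contDiffOn
  nondegenerate t ht := by
    rw [h.derivWithin_radialProfile (mem_Ici.2 (le_of_lt ht)), one_sub_slope_sq]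
    have := lorentzFactor_pos a t
    positivity
  equation t ht := by
    have ht' : t ∈ Ici (0 : ℝ) := mem_Ici.2 (le_of_lt ht)
    have h0 : t ≠ 0 := ne_of_gt ht
    have := lorentzFactor_pos a t
    rw [h.derivWithin_radialProfile ht', h.iteratedDerivWithin_two_radialProfile ht',
      one_sub_slope_sq, slopeQuotient]
    push_cast
    field_simp
    ring
  init := by simp [radialProfile]
  init_deriv := by rw [h.derivWithin_radialProfile self_mem_Ici, zero_mul]

end IsRadialMomentum

/-! ### Uniqueness of the profile. -/

/-- Grönwall: `(f - g)² exp (-2t)` is nonincreasing and starts at `0`. At the singular endpoint only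
continuity is needed. -/
theorem eqOn_of_abs_sub_deriv_le {f g f' g' : ℝ → ℝ} (hf : ContinuousOn f (Ici 0))
    (hg : ContinuousOn g (Ici 0)) (hf' : ∀ t > 0, HasDerivAt f (f' t) t)
    (hg' : ∀ t > 0, HasDerivAt g (g' t) t) (hle : ∀ t > 0, |f' t - g' t| ≤ |f t - g t|)
    (h0 : f 0 = g 0) : EqOn f g (Ici 0) := by
  have hd : ∀ t > 0, HasDerivAt (fun t => (f t - g t) ^ 2 * Real.exp (-2 * t))
      ((2 * (f t - g t) * (f' t - g' t)) * Real.exp (-2 * t) +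
        (f t - g t) ^ 2 * (Real.exp (-2 * t) * -2)) t := by
    intro t ht
    have h1 := ((hf' t ht).sub (hg' t ht)).pow 2
    have h2 : HasDerivAt (fun t : ℝ => -2 * t) (-2) t := by
      simpa using (hasDerivAt_id t).const_mul (-2 : ℝ)
    refine (h1.mul h2.exp).congr_deriv ?_
    simp
  have hanti : AntitoneOn (fun t => (f t - g t) ^ 2 * Real.exp (-2 * t)) (Ici 0) := by
    refine antitoneOn_of_deriv_nonpos (convex_Ici 0) (by fun_prop) ?_ ?_
    · rw [interior_Ici]
      exact fun t ht => (hd t ht).differentiableAt.differentiableWithinAt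
    · rw [interior_Ici]
      intro t ht
      rw [(hd t ht).deriv]
      have h1 : (f t - g t) * (f' t - g' t) ≤ (f t - g t) ^ 2 := by
        calc (f t - g t) * (f' t - g' t) ≤ |f t - g t| * |f' t - g' t| := by
              rw [← abs_mul]
              exact le_abs_self _
          _ ≤ |f t - g t| * |f t - g t| := 
              mul_le_mul_of_nonneg_left (hle t ht) (abs_nonneg _)
          _ = (f t - g t) ^ 2 := by rw [← sq, sq_abs]
      nlinarith [Real.exp_pos (-2 * t)]
  intro t ht
  have h := hanti self_mem_Ici ht ht
  simp only [h0, sub_self, ne_eq, OfNat.ofNat_ne_zero, not_false_eq_true, zero_pow, zero_mul] at h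
  have h2 : (f t - g t) ^ 2 = 0 := by
    have h3 := Real.exp_pos (-2 * t)
    nlinarith [sq_nonneg (f t - g t)]
  exact sub_eq_zero.1 (pow_eq_zero_iff two_ne_zero |>.1 h2)

/-- The integrated momentum `tᵐ r' / √(1 - r'²)` of a profile `r`. -/
noncomputable def profileMomentum (m : ℕ) (r : ℝ → ℝ) (t : ℝ) : ℝ :=
  t ^ m * (derivWithin r (Ici 0) t / √(1 - derivWithin r (Ici 0) t ^ 2))

namespace IsProfile

variable {m : ℕ} {r s : ℝ → ℝ}

theorem continuousOn_derivWithin {n : ℕ} (h : IsProfile n r) :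
    ContinuousOn (derivWithin r (Ici 0)) (Ici 0) :=
  h.contDiffOn.continuousOn_derivWithin (uniqueDiffOn_Ici 0) (by norm_num)

theorem hasDerivAt_derivWithin {n : ℕ} (h : IsProfile n r) {t : ℝ} (ht : 0 < t) :
    HasDerivAt (derivWithin r (Ici 0)) (iteratedDerivWithin 2 r (Ici 0) t) t := by
  have h1 : ContDiffOn ℝ 1 (derivWithin r (Ici 0)) (Ici 0) :=
    h.contDiffOn.derivWithin (uniqueDiffOn_Ici 0) (by norm_num)
  have h2 := (h1.differentiableOn (by norm_num) t ht.le).hasDerivWithinAt.hasDerivAt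
    (Ici_mem_nhds ht)
  rw [show (2 : ℕ) = 1 + 1 from rfl, iteratedDerivWithin_succ, iteratedDerivWithin_one]
  exact h2

/-- By continuity `r'²`, which starts at `0`, would have to take the forbidden value `1` before
exceeding it. -/
theorem derivWithin_sq_lt_one {n : ℕ} (h : IsProfile n r) {t : ℝ} (ht : 0 ≤ t) :
    derivWithin r (Ici 0) t ^ 2 < 1 := by
  by_contra! hc
  have hcont : ContinuousOn (fun t => derivWithin r (Ici 0) t ^ 2) (Icc 0 t) :=
    (h.continuousOn_derivWithin.pow 2).mono Icc_subset_Ici_self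
  obtain ⟨s, hs, he⟩ := intermediate_value_Icc ht hcont
    (show (1 : ℝ) ∈ Icc _ _ from ⟨by simp [h.init_deriv], hc⟩)
  simp only at he
  rcases hs.1.eq_or_lt with rfl | h0
  · simp [h.init_deriv] at he
  · exact h.nondegenerate s h0 (by rw [he, sub_self])

theorem continuousOn_profileMomentum {n : ℕ} (h : IsProfile n r) (m : ℕ) :
    ContinuousOn (profileMomentum m r) (Ici 0) := by
  have hc := h.continuousOn_derivWithin
  refine (continuousOn_id.pow m).mul (hc.div (by fun_prop) fun t ht => ?_)
  have := h.derivWithin_sq_lt_one ht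
  exact (Real.sqrt_pos.2 (by linarith)).ne'

/-- Solved for `r''`, the equation is `p' = (1 - p²)(1 - m p / t)`. The factor `tᵐ` absorbs the
singular term, leaving `tᵐ / √(1 - p²)`. -/
theorem hasDerivAt_profileMomentum (h : IsProfile (m + 1) r) {t : ℝ} (ht : 0 < t) :
    HasDerivAt (profileMomentum m r) (√((t ^ m) ^ 2 + profileMomentum m r t ^ 2)) t := by
  have hp := h.hasDerivAt_derivWithin ht
  have heq := h.equation t ht
  have hlt := h.derivWithin_sq_lt_one ht.le
  set p := derivWithin r (Ici 0) with hp_def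
  set p' := iteratedDerivWithin 2 r (Ici 0) t
  have hw : 0 < 1 - p t ^ 2 := by linarith
  have hs := Real.sqrt_pos.2 hw
  have hsq := Real.sq_sqrt hw.le
  have h1 := ((hp.pow 2).const_sub 1).sqrt hw.ne'
  have h2 := (hasDerivAt_pow m t).mul (hp.div h1 hs.ne')
  refine h2.congr_deriv ?_
  have e1 : √(1 - (p ^ 2) t) = √(1 - p t ^ 2) := rfl
  have hval : √((t ^ m) ^ 2 + profileMomentum m r t ^ 2) = t ^ m / √(1 - p t ^ 2) := by
    rw [profileMomentum, ← hp_def, Real.sqrt_eq_iff_mul_self_eq (by positivity) (by positivity)]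
    field_simp
    rw [hsq]
    ring
  have hp' : p' = (1 - p t ^ 2) * (1 - m / t * p t) := by
    push_cast at heq
    field_simp at heq ⊢
    linear_combination heq
  rw [hval]
  simp only [Pi.div_apply, e1]
  clear heq hval e1 h2 h1 hp
  have hp' : p' = √(1 - p t ^ 2) ^ 2 * (1 - m / t * p t) := by rw [hp', hsq]
  have hp2 : p t ^ 2 = 1 - √(1 - p t ^ 2) ^ 2 := by rw [hsq]; ring
  clear_value p'
  subst hp'
  generalize √(1 - p t ^ 2) = w at *
  simp only [Nat.cast_ofNat, Nat.add_one_sub_one, pow_one]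
  cases m with
  | zero =>
    simp only [pow_zero, Nat.cast_zero]
    field_simp
    linear_combination t * hp2
  | succ m =>
    simp only [Nat.add_sub_cancel]
    field_simp
    push_cast
    linear_combination t * t ^ m * (t - (m + 1) * p t) * hp2

theorem eqOn_derivWithin (hr : IsProfile (m + 1) r) (hs : IsProfile (m + 1) s) :
    EqOn (derivWithin r (Ici 0)) (derivWithin s (Ici 0)) (Ici 0) := by
  have he : EqOn (profileMomentum m r) (profileMomentum m s) (Ici 0) := by
    refine eqOn_of_abs_sub_deriv_le (hr.continuousOn_profileMomentum m)
      (hs.continuousOn_profileMomentum m) (fun t ht => hr.hasDerivAt_profileMomentum ht)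
      (fun t ht => hs.hasDerivAt_profileMomentum ht)
      (fun t _ => abs_sqrt_add_sq_sub_le (by positivity) _ _) ?_
    simp [profileMomentum, hr.init_deriv, hs.init_deriv]
  -- The slope is recovered from the momentum by `q ↦ q / √(1 + q²)`.
  have key : ∀ {p : ℝ}, p ^ 2 < 1 →
      p = (p / √(1 - p ^ 2)) / √(1 + (p / √(1 - p ^ 2)) ^ 2) := by
    intro p hp
    have hw : 0 < 1 - p ^ 2 := by linarith
    have hq := Real.sqrt_pos.2 hw
    have e : 1 + (p / √(1 - p ^ 2)) ^ 2 = (√(1 - p ^ 2))⁻¹ ^ 2 := by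
      rw [div_pow, inv_pow, Real.sq_sqrt hw.le]
      field_simp
      ring
    rw [e, Real.sqrt_sq (by positivity)]
    field_simp
  intro t ht
  rcases (mem_Ici.1 ht).eq_or_lt with rfl | h0
  · rw [hr.init_deriv, hs.init_deriv]
  · have h1 := mul_left_cancel₀ (pow_ne_zero m h0.ne') (he ht)
    rw [key (hr.derivWithin_sq_lt_one ht), key (hs.derivWithin_sq_lt_one ht), h1]

theorem eqOn (hr : IsProfile (m + 1) r) (hs : IsProfile (m + 1) s) : EqOn r s (Ici 0) := by
  refine (convex_Ici (0 : ℝ)).eqOn_of_fderivWithin_eq (𝕜 := ℝ)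
    (hr.contDiffOn.differentiableOn (by norm_num)) (hs.contDiffOn.differentiableOn (by norm_num))
    (uniqueDiffOn_Ici 0) (fun t ht => ?_) self_mem_Ici (by rw [hr.init, hs.init])
  ext
  exact hr.eqOn_derivWithin hs ht

end IsProfile

/-! ### Functions of the distance to a point. -/

section Radial

variable {E : Type*} [NormedAddCommGroup E] [InnerProductSpace ℝ E]

theorem HasDerivAt.hasFDerivAt_comp_norm_sub {g : ℝ → ℝ} {g' : ℝ} {x x₀ : E} (hx : x ≠ x₀)
    (hg : HasDerivAt g g' ‖x - x₀‖) :
    HasFDerivAt (fun y => g ‖y - x₀‖) ((g' / ‖x - x₀‖) • innerSL ℝ (x - x₀)) x := by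
  have h0 : 0 < ‖x - x₀‖ := norm_pos_iff.2 (sub_ne_zero.2 hx)
  have h1 : HasFDerivAt (fun y => ‖y - x₀‖ ^ 2) (2 • innerSL ℝ (x - x₀)) x := by
    exact (hasStrictFDerivAt_norm_sq (x - x₀)).hasFDerivAt.comp x
      ((hasFDerivAt_id x).sub_const x₀)
  have h2 := h1.sqrt (by positivity)
  simp only [Real.sqrt_sq (norm_nonneg _)] at h2
  refine (hg.comp_hasFDerivAt x h2).congr_fderiv ?_
  ext v
  simp
  field_simp

/-- At `x₀` the norm is not differentiable in general, but `g'(0) = 0` makes the increment of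
`g(‖v‖)` an `o(‖v‖)`. -/
theorem hasFDerivAt_comp_norm_sub {g h : ℝ → ℝ} (hg : Differentiable ℝ g)
    (hh : ∀ t, deriv g t = t * h t) (x₀ x : E) :
    HasFDerivAt (fun y => g ‖y - x₀‖) (h ‖x - x₀‖ • innerSL ℝ (x - x₀)) x := by
  rcases eq_or_ne x x₀ with rfl | hx
  · have h0 : HasDerivAt g 0 0 := by
      have := (hg 0).hasDerivAt
      rwa [hh, zero_mul] at this
    rw [hasFDerivAt_iff_isLittleO_nhds_zero]
    rw [hasDerivAt_iff_isLittleO_nhds_zero] at h0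
    have h1 : Tendsto (fun v : E => ‖v‖) (𝓝 0) (𝓝 0) := tendsto_norm_zero
    have h2 := h0.comp_tendsto h1
    rw [← Asymptotics.isLittleO_norm_right]
    simpa [Function.comp_def] using h2
  · have h0 : ‖x - x₀‖ ≠ 0 := norm_ne_zero_iff.2 (sub_ne_zero.2 hx)
    have h1 := (hg ‖x - x₀‖).hasDerivAt.hasFDerivAt_comp_norm_sub hx
    rwa [hh, mul_div_cancel_left₀ _ h0] at h1

/-- An even smooth function of the distance to a point is smooth. -/
theorem contDiff_comp_norm_sub {g : ℝ → ℝ} (hg : ContDiff ℝ ∞ g) (he : ∀ t, g (-t) = g t)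
    (x₀ : E) : ContDiff ℝ ∞ fun x => g ‖x - x₀‖ := by
  refine contDiff_infty.2 fun k => ?_
  induction k generalizing g with
  | zero =>
    have := hg.continuous
    exact contDiff_zero.2 (by fun_prop)
  | succ k ih =>
    -- The differential is `h(|x - x₀|)` times a linear expression in `x - x₀`, and `h` is again
    -- even and smooth, so the induction closes.
    obtain ⟨h, hs, hev, hd⟩ := exists_deriv_eq_mul_of_even hg he
    push_cast
    rw [contDiff_succ_iff_hasFDerivAt]
    exact ⟨fun x => h ‖x - x₀‖ • innerSL ℝ (x - x₀),
      (ih hs hev).smul ((innerSL ℝ).contDiff.comp (contDiff_id.sub contDiff_const)),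
      hasFDerivAt_comp_norm_sub (hg.differentiable (by simp)) hd x₀⟩

end Radial

theorem HasFDerivAt.gradient_eq_smul {E : Type*} [NormedAddCommGroup E] [InnerProductSpace ℝ E]
    [CompleteSpace E] {u : E → ℝ} {c : ℝ} {v x : E} (h : HasFDerivAt u (c • innerSL ℝ v) x) :
    ∇ u x = c • v := by
  apply HasGradientAt.gradient
  rw [hasGradientAt_iff_hasFDerivAt]
  refine h.congr_fderiv ?_
  ext w
  simp

theorem euclideanDiv_smul_sub {n : ℕ} {φ : EuclideanSpace ℝ (Fin n) → ℝ} {d : ℝ}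
    {x x₀ : EuclideanSpace ℝ (Fin n)} (h : HasFDerivAt φ (d • innerSL ℝ (x - x₀)) x) :
    euclideanDiv (fun y => φ y • (y - x₀)) x = d * ‖x - x₀‖ ^ 2 + n * φ x := by
  have h1 := h.smul ((hasFDerivAt_id x).sub_const x₀)
  have e : (fun y => φ y • (y - x₀)) = (φ • fun y => id y - x₀) := rfl
  rw [euclideanDiv, e, h1.fderiv]
  simp only [EuclideanSpace.norm_sq_eq, Finset.mul_sum]
  rw [show (n : ℝ) * φ x = ∑ _i : Fin n, φ x by simp, ← Finset.sum_add_distrib]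
  refine Finset.sum_congr rfl fun i _ => ?_
  simp [EuclideanSpace.inner_single_right]
  ring

theorem euclideanDiv_congr {n : ℕ} {F G : EuclideanSpace ℝ (Fin n) → EuclideanSpace ℝ (Fin n)}
    {x : EuclideanSpace ℝ (Fin n)} (h : F =ᶠ[𝓝 x] G) : euclideanDiv F x = euclideanDiv G x := by
  rw [euclideanDiv, euclideanDiv, h.fderiv_eq]

/-! ### Radial solitons from the profile, and conversely. -/

namespace IsRadialMomentum

variable {m : ℕ} {a : ℝ → ℝ}

theorem hasFDerivAt_radial (h : IsRadialMomentum m a) {E : Type*} [NormedAddCommGroup E]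
    [InnerProductSpace ℝ E] (x₀ : E) (c : ℝ) (x : E) :
    HasFDerivAt (fun x => radialProfile a ‖x - x₀‖ + c)
      (slopeQuotient a ‖x - x₀‖ • innerSL ℝ (x - x₀)) x :=
  (hasFDerivAt_comp_norm_sub (h.contDiff_radialProfile.differentiable (by simp))
    (fun t => by rw [h.deriv_radialProfile]) x₀ x).add_const c

theorem contDiff_radial (h : IsRadialMomentum m a) {E : Type*} [NormedAddCommGroup E]
    [InnerProductSpace ℝ E] (x₀ : E) (c : ℝ) :
    ContDiff ℝ ∞ (fun x => radialProfile a ‖x - x₀‖ + c) :=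
  (contDiff_comp_norm_sub h.contDiff_radialProfile h.radialProfile_neg x₀).add contDiff_const

/-- The Lorentz factor cancels in the field, leaving `a(|x - x₀|)(x - x₀)`. It is smooth at the
vertex too, so one divergence computation covers every point. -/
theorem isSolitonSolution (h : IsRadialMomentum m a) (x₀ : EuclideanSpace ℝ (Fin (m + 1))) (c : ℝ) :
    IsSolitonSolution fun x => radialProfile a ‖x - x₀‖ + c := by
  have hgrad : ∀ x, ∇ (fun x => radialProfile a ‖x - x₀‖ + c) x =
      slopeQuotient a ‖x - x₀‖ • (x - x₀) := fun x => (h.hasFDerivAt_radial x₀ c x).gradient_eq_smul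
  have hnorm : ∀ x, ‖∇ (fun x => radialProfile a ‖x - x₀‖ + c) x‖ =
      ‖x - x₀‖ * slopeQuotient a ‖x - x₀‖ := fun x => by
    rw [hgrad, norm_smul, Real.norm_of_nonneg (h.slopeQuotient_pos _).le, mul_comm]
  have hsqrt : ∀ x, √(1 - ‖∇ (fun x => radialProfile a ‖x - x₀‖ + c) x‖ ^ 2) =
      (lorentzFactor a ‖x - x₀‖)⁻¹ := fun x => by
    rw [hnorm, one_sub_slope_sq, ← inv_pow,
      Real.sqrt_sq (inv_nonneg.2 (lorentzFactor_pos a _).le)]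
  refine ⟨(h.contDiff_radial x₀ c).of_le (by norm_cast), fun x => ?_, fun x => ?_⟩
  · rw [hnorm]
    exact slope_lt_one a _
  · have hfield : lorentzField (fun x => radialProfile a ‖x - x₀‖ + c) =
        fun y => a ‖y - x₀‖ • (y - x₀) := by
      funext y
      rw [lorentzField, hsqrt, hgrad, inv_inv, smul_smul, slopeQuotient,
        mul_div_cancel₀ _ (lorentzFactor_pos a _).ne']
    obtain ⟨k, -, -, hk⟩ := exists_deriv_eq_mul_of_even h.contDiff h.even
    rw [hfield, hsqrt, euclideanDiv_smul_sub
      (hasFDerivAt_comp_norm_sub (h.contDiff.differentiable (by simp)) hk x₀ x), one_div, inv_inv,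
      lorentzFactor, ← h.equation, hk]
    push_cast
    ring

end IsRadialMomentum

/-- The restriction of a radially symmetric soliton solution to a ray from its vertex is a
profile. -/
theorem IsSolitonSolution.exists_isProfile {m : ℕ} {u : EuclideanSpace ℝ (Fin (m + 1)) → ℝ}
    {x₀ : EuclideanSpace ℝ (Fin (m + 1))} (hu : IsSolitonSolution u) (hr : IsRadialAbout u x₀) :
    ∃ g : ℝ → ℝ, IsProfile (m + 1) g ∧ ∀ x, u x = g ‖x - x₀‖ + u x₀ := by
  set e : EuclideanSpace ℝ (Fin (m + 1)) := EuclideanSpace.single 0 1 with he_def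
  have he : ‖e‖ = 1 := by simp [he_def]
  have hray : ∀ t : ℝ, ‖x₀ + t • e - x₀‖ = |t| := fun t => by simp [norm_smul, he]
  set g : ℝ → ℝ := fun t => u (x₀ + t • e) - u x₀ with hg_def
  have hg : ContDiff ℝ 2 g :=
    (hu.contDiff.comp (contDiff_const.add (contDiff_id.smul contDiff_const))).sub contDiff_const
  have hgd : Differentiable ℝ g := hg.differentiable (by norm_num)
  have hg1 : ContDiff ℝ 1 (deriv g) := by
    rw [show (2 : ℕ∞ω) = 1 + 1 by norm_num] at hg
    exact (contDiff_succ_iff_deriv.1 hg).2.2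
  have hgd1 : Differentiable ℝ (deriv g) := hg1.differentiable (by norm_num)
  have heven : ∀ t, g (-t) = g t := fun t => by
    simp only [hg_def]
    rw [hr (x₀ + -t • e) (x₀ + t • e) (by rw [hray, hray, abs_neg])]
  have hug : ∀ x, u x = g ‖x - x₀‖ + u x₀ := fun x => by
    simp only [hg_def, sub_add_cancel]
    exact hr _ _ (by rw [hray, abs_norm])
  have hgrad : ∀ x, x ≠ x₀ → ∇ u x = (deriv g ‖x - x₀‖ / ‖x - x₀‖) • (x - x₀) := fun x hx => by
    have h1 := ((hgd ‖x - x₀‖).hasDerivAt.hasFDerivAt_comp_norm_sub hx).add_const (u x₀)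
    rw [← funext hug] at h1
    exact h1.gradient_eq_smul
  have hnorm : ∀ x, x ≠ x₀ → ‖∇ u x‖ ^ 2 = deriv g ‖x - x₀‖ ^ 2 := fun x hx => by
    have h0 : 0 < ‖x - x₀‖ := norm_pos_iff.2 (sub_ne_zero.2 hx)
    rw [hgrad x hx, norm_smul, mul_pow, Real.norm_eq_abs, sq_abs]
    field_simp
  have hne : ∀ t : ℝ, 0 < t → x₀ + t • e ≠ x₀ := fun t ht h => by
    have := hray t
    rw [h, sub_self, norm_zero, abs_of_pos ht] at this
    exact ht.ne this
  have hlt : ∀ t : ℝ, 0 < t → deriv g t ^ 2 < 1 := fun t ht => by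
    have h1 := hnorm _ (hne t ht)
    rw [hray, abs_of_pos ht] at h1
    rw [← h1]
    exact pow_lt_one₀ (norm_nonneg _) (hu.spacelike _) two_ne_zero
  have hdw : ∀ t ∈ Ici (0 : ℝ), derivWithin g (Ici 0) t = deriv g t := fun t ht =>
    (hgd t).derivWithin (uniqueDiffOn_Ici 0 t ht)
  have hdw2 : ∀ t ∈ Ici (0 : ℝ), iteratedDerivWithin 2 g (Ici 0) t = deriv (deriv g) t := by
    intro t ht
    rw [show (2 : ℕ) = 1 + 1 from rfl, iteratedDerivWithin_succ, iteratedDerivWithin_one,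
      derivWithin_congr hdw (hdw t ht)]
    exact (hgd1 t).derivWithin (uniqueDiffOn_Ici 0 t ht)
  refine ⟨g, ⟨hg.contDiffOn, fun t ht => ?_, fun t ht => ?_, ?_, ?_⟩, hug⟩
  · rw [hdw t (mem_Ici.2 (le_of_lt ht))]
    exact (sub_pos.2 (hlt t ht)).ne'
  · have ht0 : 0 < t := ht
    rw [hdw t ht0.le, hdw2 t ht0.le]
    have hw : 0 < 1 - deriv g t ^ 2 := sub_pos.2 (hlt t ht)
    have hs := Real.sqrt_pos.2 hw
    have hsq := Real.sq_sqrt hw.le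
    have hp := (hgd1 t).hasDerivAt
    have h1 := ((hp.pow 2).const_sub 1).sqrt hw.ne'
    have h2 : HasDerivAt (fun τ => (√(1 - deriv g τ ^ 2))⁻¹ * (deriv g τ / τ))
        (deriv (deriv g) t / (√(1 - deriv g t ^ 2) ^ 3 * t) -
          deriv g t / (√(1 - deriv g t ^ 2) * t ^ 2)) t := by
      refine ((h1.inv hs.ne').mul (hp.div (hasDerivAt_id t) ht0.ne')).congr_deriv ?_
      have e1 : √(1 - (deriv g ^ 2) t) = √(1 - deriv g t ^ 2) := rfl
      have hp2 : deriv g t ^ 2 = 1 - √(1 - deriv g t ^ 2) ^ 2 := by rw [hsq]; ring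
      simp only [Pi.div_apply, Pi.inv_apply, e1, id, Nat.cast_ofNat, Nat.add_one_sub_one, pow_one]
      generalize √(1 - deriv g t ^ 2) = w at *
      field_simp
      linear_combination t * deriv (deriv g) t * hp2
    have hxt : ‖x₀ + t • e - x₀‖ = t := by rw [hray, abs_of_pos ht0]
    rw [← hxt] at h2
    have h3 := h2.hasFDerivAt_comp_norm_sub
      (hne t ht0)
    have hdiv := euclideanDiv_smul_sub h3
    -- The radial formula for the gradient divides by `‖y - x₀‖`, so it is used only near a point
    -- off the vertex.
    have hfield : lorentzField u =ᶠ[𝓝 (x₀ + t • e)] fun y =>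
        ((√(1 - deriv g ‖y - x₀‖ ^ 2))⁻¹ * (deriv g ‖y - x₀‖ / ‖y - x₀‖)) • (y - x₀) := by
      filter_upwards [isOpen_ne.mem_nhds (hne t ht0)] with y hy
      rw [lorentzField, hnorm y hy, hgrad y hy, smul_smul]
    have heq := hu.equation (x₀ + t • e)
    rw [euclideanDiv_congr hfield, hdiv, hnorm _ (hne t ht0), hxt] at heq
    rw [← hsq]
    push_cast at heq ⊢
    generalize √(1 - deriv g t ^ 2) = w at *
    field_simp at heq ⊢
    linear_combination heq
  · simp [hg_def]
  · rw [hdw 0 self_mem_Ici]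
    -- Radial symmetry makes `g` even on the full line, which forces `g'(0) = 0`.
    have := deriv_neg_of_even heven 0
    rw [neg_zero] at this
    linarith

/-! ### Convexity and growth. -/

theorem strictConvexOn_univ_of_hessian_pos {E : Type*} [NormedAddCommGroup E] [NormedSpace ℝ E]
    {u : E → ℝ} (hu : ContDiff ℝ 2 u)
    (hpos : ∀ x v : E, v ≠ 0 → 0 < iteratedFDeriv ℝ 2 u x ![v, v]) :
    StrictConvexOn ℝ univ u := by
  refine ⟨convex_univ, fun x _ y _ hxy α β hα hβ hαβ => ?_⟩
  have hline : ∀ t : ℝ, HasDerivAt (fun t : ℝ => x + t • (y - x)) (y - x) t := fun t => by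
    simpa using ((hasDerivAt_id t).smul_const (y - x)).const_add x
  have hd : Differentiable ℝ u := hu.differentiable (by norm_num)
  have hd1 : Differentiable ℝ (fderiv ℝ u) :=
    (hu.fderiv_right (m := 1) (by norm_num)).differentiable (by norm_num)
  have h1 : ∀ t : ℝ, HasDerivAt (fun t : ℝ => u (x + t • (y - x)))
      (fderiv ℝ u (x + t • (y - x)) (y - x)) t := fun t =>
    (hd _).hasFDerivAt.comp_hasDerivAt t (hline t)
  have h2 : ∀ t : ℝ, HasDerivAt (fun t : ℝ => fderiv ℝ u (x + t • (y - x)) (y - x))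
      (fderiv ℝ (fderiv ℝ u) (x + t • (y - x)) (y - x) (y - x)) t := fun t =>
    (((hd1 _).hasFDerivAt.comp_hasDerivAt t (hline t)).clm_apply
      (hasDerivAt_const t (y - x))).congr_deriv (by simp)
  have hconv : StrictConvexOn ℝ univ fun t : ℝ => u (x + t • (y - x)) := by
    refine strictConvexOn_univ_of_deriv2_pos
      (continuous_iff_continuousAt.2 fun t => (h1 t).continuousAt) fun t => ?_
    rw [Function.iterate_succ, Function.iterate_one, Function.comp_apply,
      funext fun t => (h1 t).deriv, (h2 t).deriv]
    simpa [iteratedFDeriv_two_apply] using hpos (x + t • (y - x)) (y - x) (sub_ne_zero.2 hxy.symm)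
  have h := hconv.2 (mem_univ 0) (mem_univ 1) zero_ne_one hα hβ hαβ
  have e : x + (α • (0 : ℝ) + β • (1 : ℝ)) • (y - x) = α • x + β • y := by
    rw [← eq_sub_iff_add_eq] at hαβ
    subst hαβ
    simp only [smul_eq_mul, mul_zero, mul_one, zero_add]
    module
  simp only [e] at h
  simpa using h

namespace IsRadialMomentum

variable {m : ℕ} {a : ℝ → ℝ} {E : Type*} [NormedAddCommGroup E]

/-- With `ρ' = t k`, the Hessian form is `ρ |v|² + k ⟨x - x₀, v⟩²`. For `k ≥ 0` it is clearly
positive; for `k < 0` Cauchy–Schwarz bounds it below by `(ρ + t² k) |v|² = r'' |v|²`. -/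
theorem hessian_radial_pos [InnerProductSpace ℝ E] (h : IsRadialMomentum m a) (x₀ : E) (c : ℝ)
    (x v : E) (hv : v ≠ 0) :
    0 < iteratedFDeriv ℝ 2 (fun x => radialProfile a ‖x - x₀‖ + c) x ![v, v] := by
  obtain ⟨k, -, -, hk⟩ := exists_deriv_eq_mul_of_even h.contDiff_slopeQuotient h.slopeQuotient_neg
  have hρd := h.contDiff_slopeQuotient.differentiable (by simp)
  have h1 := hasFDerivAt_comp_norm_sub hρd hk x₀ x
  have h2 : HasFDerivAt (fun y => innerSL ℝ (y - x₀)) (innerSL ℝ : E →L[ℝ] E →L[ℝ] ℝ) x :=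
    (innerSL ℝ : E →L[ℝ] E →L[ℝ] ℝ).hasFDerivAt.comp x ((hasFDerivAt_id x).sub_const x₀)
  have h3 := h1.smul h2
  have e : fderiv ℝ (fun x => radialProfile a ‖x - x₀‖ + c) =
      (fun y => slopeQuotient a ‖y - x₀‖) • fun y => innerSL ℝ (y - x₀) :=
    funext fun y => (h.hasFDerivAt_radial x₀ c y).fderiv
  set t := ‖x - x₀‖ with ht
  have hval : iteratedFDeriv ℝ 2 (fun x => radialProfile a ‖x - x₀‖ + c) x ![v, v] =
      slopeQuotient a t * ‖v‖ ^ 2 + k t * inner ℝ (x - x₀) v ^ 2 := by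
    rw [iteratedFDeriv_two_apply, e, h3.fderiv]
    simp only [Matrix.cons_val_zero, Matrix.cons_val_one, add_apply, smul_apply,
      ContinuousLinearMap.smulRight_apply, innerSL_apply_apply, smul_eq_mul]
    have hself : innerSL ℝ v v = ‖v‖ ^ 2 := real_inner_self_eq_norm_sq v
    linear_combination slopeQuotient a t * hself
  rw [hval]
  have hρ := h.slopeQuotient_pos t
  have hv0 : 0 < ‖v‖ ^ 2 := by positivity
  have hslope : 0 < slopeQuotient a t + t ^ 2 * k t := by
    have h4 := (hasDerivAt_id t).mul (hρd t).hasDerivAt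
    have h5 := (h.hasDerivAt_slope t).unique h4
    have h6 := h.deriv_slope_pos (norm_nonneg (x - x₀))
    rw [← ht, h5, hk] at h6
    simp only [id] at h6
    linarith
  have hcs : inner ℝ (x - x₀) v ^ 2 ≤ t ^ 2 * ‖v‖ ^ 2 := by
    rw [← mul_pow, ← sq_abs]
    exact pow_le_pow_left₀ (abs_nonneg _) (abs_real_inner_le_norm _ _) 2
  rcases le_or_gt 0 (k t) with hk0 | hk0
  · positivity
  · nlinarith [mul_pos hslope hv0, mul_le_mul_of_nonpos_left hcs hk0.le]

/-- The slope bounds make `t - r` and `r - √((m + 1)² + t²)` nondecreasing; the constant is the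
value of the root at `0`. -/
theorem abs_radialProfile_sub_le (h : IsRadialMomentum m a) {t : ℝ} (ht : 0 ≤ t) :
    |radialProfile a t - t| ≤ m + 1 := by
  have h0 : radialProfile a 0 = 0 := h.isProfile.init
  have hs : ∀ s : ℝ, HasDerivAt (fun s : ℝ => √(((m : ℝ) + 1) ^ 2 + s ^ 2))
      (s / √(((m : ℝ) + 1) ^ 2 + s ^ 2)) s := fun s => by
    have hp : 0 < ((m : ℝ) + 1) ^ 2 + s ^ 2 := by positivity
    refine (((hasDerivAt_pow 2 s).const_add (((m : ℝ) + 1) ^ 2)).sqrt hp.ne').congr_deriv ?_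
    have := Real.sqrt_pos.2 hp
    field_simp
    simp
  have hup : MonotoneOn (fun s => s - radialProfile a s) (Ici 0) := by
    have hd : ∀ s, HasDerivAt (fun s => s - radialProfile a s) (1 - s * slopeQuotient a s) s :=
      fun s => (hasDerivAt_id s).sub (h.hasDerivAt_radialProfile s)
    refine monotoneOn_of_deriv_nonneg (convex_Ici 0)
      (fun s _ => (hd s).continuousAt.continuousWithinAt)
      (fun s _ => (hd s).differentiableAt.differentiableWithinAt) fun s _ => ?_
    rw [(hd s).deriv]
    linarith [slope_lt_one a s]
  have hlo : MonotoneOn (fun s => radialProfile a s - √(((m : ℝ) + 1) ^ 2 + s ^ 2)) (Ici 0) := by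
    have hd := fun s => (h.hasDerivAt_radialProfile s).sub (hs s)
    refine monotoneOn_of_deriv_nonneg (convex_Ici 0)
      (fun s _ => (hd s).continuousAt.continuousWithinAt)
      (fun s _ => (hd s).differentiableAt.differentiableWithinAt) fun s hs' => ?_
    rw [interior_Ici] at hs'
    have := (hd s).deriv
    rw [show (fun s => radialProfile a s - √(((m : ℝ) + 1) ^ 2 + s ^ 2)) =
      radialProfile a - fun s => √(((m : ℝ) + 1) ^ 2 + s ^ 2) from rfl, this]
    linarith [h.le_slope (le_of_lt hs')]
  have h1 := hup self_mem_Ici ht ht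
  have h2 := hlo self_mem_Ici ht ht
  have h3 : t ≤ √(((m : ℝ) + 1) ^ 2 + t ^ 2) := Real.le_sqrt_of_sq_le (by nlinarith)
  have h4 : √(((m : ℝ) + 1) ^ 2 + 0 ^ 2) = m + 1 := by
    rw [zero_pow two_ne_zero, add_zero, Real.sqrt_sq (by positivity)]
  simp only [h0, h4] at h1 h2
  rw [abs_le]
  constructor <;> linarith

theorem tendsto_radial_div_norm [ProperSpace E] (h : IsRadialMomentum m a) (x₀ : E) (c : ℝ) :
    Tendsto (fun x => (radialProfile a ‖x - x₀‖ + c) / ‖x‖) (cocompact E) (𝓝 1) := by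
  have hn : Tendsto (fun x : E => ‖x‖) (cocompact E) atTop := tendsto_norm_cocompact_atTop
  have hK : Tendsto (fun x : E => (m + 1 + ‖x₀‖ + |c|) / ‖x‖) (cocompact E) (𝓝 0) :=
    tendsto_const_nhds.div_atTop hn
  rw [tendsto_iff_dist_tendsto_zero]
  refine squeeze_zero' (Eventually.of_forall fun _ => dist_nonneg) ?_ hK
  filter_upwards [hn.eventually_gt_atTop 0] with x hx
  rw [Real.dist_eq, div_sub_one hx.ne', abs_div, abs_of_pos hx]
  gcongr
  have h1 := abs_le.1 (h.abs_radialProfile_sub_le (norm_nonneg (x - x₀)))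
  have h2 := abs_le.1 (abs_norm_sub_norm_le (x - x₀) x)
  have h3 : ‖x - x₀ - x‖ = ‖x₀‖ := by rw [sub_sub_cancel_left, norm_neg]
  rw [h3] at h2
  have h4 := abs_le.1 (le_refl |c|)
  rw [abs_le]
  constructor <;> linarith [h1.1, h1.2, h2.1, h2.2, h4.1, h4.2]

end IsRadialMomentum

/-! ### Translating solitons and the main theorem. -/

theorem IsTranslatingSoliton.isSolitonSolution {n : ℕ} {u : EuclideanSpace ℝ (Fin n) → ℝ}
    (hu : IsTranslatingSoliton u) : IsSolitonSolution u := by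
  have e : (fun x => u x + 0) = u := funext fun x => add_zero _
  have hc := hu.contDiff 0
  have hs := hu.spacelike 0
  have he := hu.equation 0
  simp only [e] at hc hs he
  refine ⟨hc, hs, fun x => ?_⟩
  have h1 : HasDerivAt (fun τ : ℝ => u x + τ) 1 0 := (hasDerivAt_id 0).const_add (u x)
  have h2 := (he x).unique h1
  have h3 : 0 < 1 - ‖∇ u x‖ ^ 2 :=
    sub_pos.2 (pow_lt_one₀ (norm_nonneg _) (hs x) two_ne_zero)
  rw [eq_div_iff (Real.sqrt_pos.2 h3).ne', mul_comm]
  exact h2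

theorem theorem1p1 (n : ℕ) (hn : 1 ≤ n) :
    ∃ r : ℝ → ℝ,
      -- existence and uniqueness for the singular initial value problem on `[0, ∞)`
      IsProfile n r ∧
      (∀ s : ℝ → ℝ, IsProfile n s → EqOn s r (Ici 0)) ∧
      -- every radially symmetric solution is given by `r`, and `r` gives such solutions
      (∀ (u : EuclideanSpace ℝ (Fin n) → ℝ) (x₀ : EuclideanSpace ℝ (Fin n)),
        IsSolitonSolution u → IsRadialAbout u x₀ → ∀ x, u x = r ‖x - x₀‖ + u x₀) ∧
      (∀ (x₀ : EuclideanSpace ℝ (Fin n)) (c : ℝ),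
        IsSolitonSolution (fun x => r ‖x - x₀‖ + c)) ∧
      -- regularity and estimates for `r`
      ContDiffOn ℝ ∞ r (Ici 0) ∧
      (∀ t ∈ Ici (0 : ℝ), t / Real.sqrt ((n : ℝ) ^ 2 + t ^ 2) ≤ derivWithin r (Ici 0) t ∧
        derivWithin r (Ici 0) t < 1) ∧
      (∀ t ∈ Ici (0 : ℝ), 0 < iteratedDerivWithin 2 r (Ici 0) t ∧
        iteratedDerivWithin 2 r (Ici 0) t ≤ 1) ∧
      -- rotationally symmetric solitons are smooth, strictly convex and of linear growth
      (∀ (u : EuclideanSpace ℝ (Fin n) → ℝ) (x₀ : EuclideanSpace ℝ (Fin n)),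
        IsTranslatingSoliton u → IsRadialAbout u x₀ →
          ContDiff ℝ ∞ u ∧
          StrictConvexOn ℝ univ u ∧
          (∀ x v : EuclideanSpace ℝ (Fin n), v ≠ 0 → 0 < iteratedFDeriv ℝ 2 u x ![v, v]) ∧
          Tendsto (fun x => u x / ‖x‖) (cocompact (EuclideanSpace ℝ (Fin n))) (𝓝 1)) ∧
      -- and unique up to a translation of `ℝⁿ⁺¹`
      (∀ (u w : EuclideanSpace ℝ (Fin n) → ℝ) (x₀ y₀ : EuclideanSpace ℝ (Fin n)),
        IsTranslatingSoliton u → IsRadialAbout u x₀ →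
        IsTranslatingSoliton w → IsRadialAbout w y₀ →
          ∃ (a : EuclideanSpace ℝ (Fin n)) (c : ℝ), ∀ x, w x = u (x - a) + c) := by
  obtain ⟨m, rfl⟩ : ∃ m, n = m + 1 := ⟨n - 1, by omega⟩
  obtain ⟨a, ha⟩ := exists_isRadialMomentum m
  have hrep : ∀ (u : EuclideanSpace ℝ (Fin (m + 1)) → ℝ) (x₀ : EuclideanSpace ℝ (Fin (m + 1))),
      IsSolitonSolution u → IsRadialAbout u x₀ → ∀ x, u x = radialProfile a ‖x - x₀‖ + u x₀ := by
    intro u x₀ hu hr x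
    obtain ⟨g, hg, hug⟩ := hu.exists_isProfile hr
    rw [hug x, hg.eqOn ha.isProfile (norm_nonneg (x - x₀))]
  refine ⟨radialProfile a, ha.isProfile, fun s hs => hs.eqOn ha.isProfile, hrep,
    ha.isSolitonSolution, ha.contDiff_radialProfile.contDiffOn, fun t ht => ?_, fun t ht => ?_,
    fun u x₀ hu hr => ?_, fun u w x₀ y₀ hu hur hw hwr => ?_⟩
  · rw [ha.derivWithin_radialProfile ht]
    push_cast
    exact ⟨ha.le_slope ht, slope_lt_one a t⟩
  · rw [ha.iteratedDerivWithin_two_radialProfile ht]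
    exact ⟨ha.deriv_slope_pos ht, ha.deriv_slope_le_one t⟩
  · rw [funext (hrep u x₀ hu.isSolitonSolution hr)]
    have hsm := ha.contDiff_radial x₀ (u x₀)
    have hpos := ha.hessian_radial_pos x₀ (u x₀)
    exact ⟨hsm, strictConvexOn_univ_of_hessian_pos (hsm.of_le (by norm_cast)) hpos, hpos,
      ha.tendsto_radial_div_norm x₀ (u x₀)⟩
  -- The horizontal shift matches the vertices, the vertical one the values there.
  · refine ⟨y₀ - x₀, w y₀ - u x₀, fun x => ?_⟩
    rw [hrep w y₀ hw.isSolitonSolution hwr x, hrep u x₀ hu.isSolitonSolution hur (x - (y₀ - x₀)),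
      show x - (y₀ - x₀) - x₀ = x - y₀ by abel]
    ring
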